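/- Let $D$ be an integral domain with quotient field $K$, and let $F(D)$ be the set of nonzero fractional ideals of $D$. A star operation on $D$ is a map $*\colon F(D)\to F(D)$, $I\mapsto I^*$, such that for all $0\ne a\in K$ and all $I,J\in F(D)$: $D^*=D$ and $(aI)^*=aI^*$; $I\subseteq I^*$, and $I\subseteq J$ implies $I^*\subseteq J^*$; and $(I^*)^*=I^*$. Let $*_f$ denote the star operation $I\mapsto I^{*_f}=\bigcup_H H^*$, where $H$ ranges over the nonzero finitely generated fractional ideals contained in $I$. The star operation $*$ is of finite character if $*=*_f$, and it is stable if $(I\cap J)^*=I^*\cap J^*$ for all $I,J\in F(D)$. The domain $D$ is $*$-sharp if, whenever $I,A,B$ are nonzero ideals of $D$ with $I\supseteq AB$, there exist nonzero ideals $H,J$ of $D$ such that $I^*=(HJ)^*$, $H^*\supseteq A$ and $J^*\supseteq B$. A $*$-ideal of $D$ is a nonzero ideal $I\subseteq D$ with $I^*=I$; a maximal $*$-ideal is an ideal that is maximal among the proper $*$-ideals of $D$ (such an ideal is prime). The $*$-dimension of $D$ is the supremum of the integers $n\ge 0$ for which there is a chain $0\subsetneq P_1\subsetneq\cdots\subsetneq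 P_n$ of prime $*$-ideals of $D$. Finally, $D$ is a P$*$MD (Prüfer $*$-multiplication domain) if $(II^{-1})^{*_f}=D$ for every nonzero finitely generated ideal $I$ of $D$, where $I^{-1}=\{x\in K\mid xI\subseteq D\}$. Proposition. Let $*$ be a stable star operation of finite character on $D$, and suppose that $D$ is $*$-sharp. Then, for every maximal $*$-ideal $M$ of $D$, the localization $D_M$ is a valuation domain whose value group is isomorphic, as an ordered group, to a complete subgroup of $\mathbb{R}$. In particular, $D$ is a P$*$MD of $*$-dimension at most $1$. -/

import Mathlib

open scoped nonZeroDivisors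

/-- A star operation on the domain `D` with quotient field `K`. It is a map on the nonzero
fractional ideals of `D`; it is stored together with its unique extension to all fractional ideals
that sends `0` to `0`. (By `le_star` it maps nonzero fractional ideals to nonzero ones.) -/
structure StarOperation (D K : Type*) [CommRing D] [IsDomain D] [Field K] [Algebra D K]
    [IsFractionRing D K] where
  /-- The underlying map `I ↦ I^*`. -/
  star : FractionalIdeal D⁰ K → FractionalIdeal D⁰ K
  star_zero : star 0 = 0
  star_one : star 1 = 1
  star_smul : ∀ (a : K) (I : FractionalIdeal D⁰ K), a ≠ 0 → I ≠ 0 →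
    star (FractionalIdeal.spanSingleton D⁰ a * I) = FractionalIdeal.spanSingleton D⁰ a * star I
  le_star : ∀ I : FractionalIdeal D⁰ K, I ≠ 0 → I ≤ star I
  star_mono : ∀ I J : FractionalIdeal D⁰ K, I ≠ 0 → J ≠ 0 → I ≤ J → star I ≤ star J
  star_star : ∀ I : FractionalIdeal D⁰ K, I ≠ 0 → star (star I) = star I

namespace StarOperation

variable {D K : Type*} [CommRing D] [IsDomain D] [Field K] [Algebra D K] [IsFractionRing D K]

theorem le_star_all (s : StarOperation D K) (I : FractionalIdeal D⁰ K) : I ≤ s.star I := by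
  by_cases h : I = 0
  · subst h; rw [s.star_zero]
  · exact s.le_star I h

theorem star_mono_all (s : StarOperation D K) {I J : FractionalIdeal D⁰ K} (h : I ≤ J) :
    s.star I ≤ s.star J := by
  by_cases hI : I = 0
  · subst hI; rw [s.star_zero]; exact FractionalIdeal.zero_le _
  · have hJ : J ≠ 0 := by
      rintro rfl
      exact hI (le_antisymm h (FractionalIdeal.zero_le _))
    exact s.star_mono I J hI hJ h

theorem star_star_all (s : StarOperation D K) (I : FractionalIdeal D⁰ K) :
    s.star (s.star I) = s.star I := by
  by_cases hI : I = 0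
  · subst hI; simp [s.star_zero]
  · exact s.star_star I hI

theorem star_smul_all (s : StarOperation D K) {a : K} (ha : a ≠ 0) (I : FractionalIdeal D⁰ K) :
    s.star (FractionalIdeal.spanSingleton D⁰ a * I) =
      FractionalIdeal.spanSingleton D⁰ a * s.star I := by
  by_cases hI : I = 0
  · subst hI; simp [s.star_zero]
  · exact s.star_smul a I ha hI

/-- The submodule `⋃_H H^*`, where `H` ranges over the finitely generated fractional subideals of
`I`. (Allowing `H = 0` adds nothing when `I ≠ 0`, and gives the value `0` at `I = 0`.) -/
def finPartSubmodule (s : StarOperation D K) (I : FractionalIdeal D⁰ K) : Submodule D K where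
  carrier := {x | ∃ H : FractionalIdeal D⁰ K, (H : Submodule D K).FG ∧ H ≤ I ∧ x ∈ s.star H}
  zero_mem' := ⟨0, by simpa using Submodule.fg_bot, FractionalIdeal.zero_le _,
    Submodule.zero_mem (s.star 0 : Submodule D K)⟩
  add_mem' := by
    rintro x y ⟨H, hH, hHI, hx⟩ ⟨H', hH', hHI', hy⟩
    refine ⟨H ⊔ H', ?_, sup_le hHI hHI', ?_⟩
    · rw [FractionalIdeal.coe_sup]; exact hH.sup hH'
    · exact Submodule.add_mem (s.star (H ⊔ H') : Submodule D K)
        (s.star_mono_all le_sup_left hx) (s.star_mono_all le_sup_right hy)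
  smul_mem' := by
    rintro c x ⟨H, hH, hHI, hx⟩
    exact ⟨H, hH, hHI, Submodule.smul_mem (s.star H : Submodule D K) c hx⟩

theorem finPartSubmodule_le (s : StarOperation D K) (I : FractionalIdeal D⁰ K) :
    s.finPartSubmodule I ≤ (s.star I : Submodule D K) := by
  rintro x ⟨H, -, hHI, hx⟩
  exact s.star_mono_all hHI hx

/-- The fractional ideal `I^{*_f} = ⋃_H H^*`. -/
def finPartFun (s : StarOperation D K) (I : FractionalIdeal D⁰ K) : FractionalIdeal D⁰ K :=
  ⟨s.finPartSubmodule I, FractionalIdeal.isFractional_of_le (s.finPartSubmodule_le I)⟩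

theorem mem_finPartFun (s : StarOperation D K) (I : FractionalIdeal D⁰ K) (x : K) :
    x ∈ s.finPartFun I ↔
      ∃ H : FractionalIdeal D⁰ K, (H : Submodule D K).FG ∧ H ≤ I ∧ x ∈ s.star H :=
  Iff.rfl

theorem finPartFun_le (s : StarOperation D K) (I : FractionalIdeal D⁰ K) :
    s.finPartFun I ≤ s.star I :=
  s.finPartSubmodule_le I

theorem le_finPartFun (s : StarOperation D K) (I : FractionalIdeal D⁰ K) :
    I ≤ s.finPartFun I := by
  intro x hx
  refine ⟨FractionalIdeal.spanSingleton D⁰ x, ?_, ?_, ?_⟩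
  · rw [FractionalIdeal.coe_spanSingleton]; exact Submodule.fg_span_singleton x
  · rwa [FractionalIdeal.spanSingleton_le_iff_mem]
  · exact s.le_star_all _ (FractionalIdeal.mem_spanSingleton_self D⁰ x)

theorem finPartFun_mono (s : StarOperation D K) {I J : FractionalIdeal D⁰ K} (h : I ≤ J) :
    s.finPartFun I ≤ s.finPartFun J := by
  rintro x ⟨H, hH, hHI, hx⟩
  exact ⟨H, hH, hHI.trans h, hx⟩

theorem exists_fg_of_le_finPartFun (s : StarOperation D K) (I : FractionalIdeal D⁰ K)
    (N : Submodule D K) (hN : N.FG) (hNI : N ≤ (s.finPartFun I : Submodule D K)) :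
    ∃ H : FractionalIdeal D⁰ K, (H : Submodule D K).FG ∧ H ≤ I ∧
      N ≤ (s.star H : Submodule D K) := by
  induction N, hN using Submodule.fg_induction with
  | singleton x =>
    obtain ⟨H, hH, hHI, hx⟩ := hNI (Submodule.mem_span_singleton_self x)
    refine ⟨H, hH, hHI, ?_⟩
    rw [Submodule.span_singleton_le_iff_mem]
    exact hx
  | sup M₁ M₂ _ _ h₁ h₂ =>
    obtain ⟨H, hH, hHI, hx⟩ := h₁ (le_sup_left.trans hNI)
    obtain ⟨H', hH', hHI', hx'⟩ := h₂ (le_sup_right.trans hNI)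
    refine ⟨H ⊔ H', ?_, sup_le hHI hHI', sup_le ?_ ?_⟩
    · rw [FractionalIdeal.coe_sup]; exact hH.sup hH'
    · exact hx.trans (s.star_mono_all le_sup_left)
    · exact hx'.trans (s.star_mono_all le_sup_right)

theorem smul_finPartFun_le (s : StarOperation D K) {a : K} (ha : a ≠ 0)
    (I : FractionalIdeal D⁰ K) :
    FractionalIdeal.spanSingleton D⁰ a * s.finPartFun I ≤
      s.finPartFun (FractionalIdeal.spanSingleton D⁰ a * I) := by
  intro x hx
  obtain ⟨y, ⟨H, hH, hHI, hy⟩, rfl⟩ := FractionalIdeal.mem_singleton_mul.mp hx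
  refine ⟨FractionalIdeal.spanSingleton D⁰ a * H, ?_, mul_le_mul_right hHI _, ?_⟩
  · rw [FractionalIdeal.coe_mul, FractionalIdeal.coe_spanSingleton]
    exact (Submodule.fg_span_singleton a).mul hH
  · rw [s.star_smul_all ha]
    exact FractionalIdeal.mem_singleton_mul.mpr ⟨y, hy, rfl⟩

/-- The star operation `*_f` of finite type associated with `*`. -/
def finPart (s : StarOperation D K) : StarOperation D K where
  star := s.finPartFun
  star_zero := le_antisymm ((s.finPartFun_le 0).trans s.star_zero.le) (FractionalIdeal.zero_le _)
  star_one := le_antisymm ((s.finPartFun_le 1).trans s.star_one.le) (s.le_finPartFun 1)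
  star_smul := by
    intro a I ha _
    refine le_antisymm ?_ (s.smul_finPartFun_le ha I)
    have hinv : FractionalIdeal.spanSingleton D⁰ a * FractionalIdeal.spanSingleton D⁰ a⁻¹ = 1 := by
      rw [FractionalIdeal.spanSingleton_mul_spanSingleton, mul_inv_cancel₀ ha,
        FractionalIdeal.spanSingleton_one]
    have h := s.smul_finPartFun_le (inv_ne_zero ha) (FractionalIdeal.spanSingleton D⁰ a * I)
    rw [← mul_assoc, mul_comm (FractionalIdeal.spanSingleton D⁰ a⁻¹)
      (FractionalIdeal.spanSingleton D⁰ a), hinv, one_mul] at h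
    have h' := mul_le_mul_right h (FractionalIdeal.spanSingleton D⁰ a)
    rwa [← mul_assoc, hinv, one_mul] at h'
  le_star := fun I _ => s.le_finPartFun I
  star_mono := fun _ _ _ _ h => s.finPartFun_mono h
  star_star := by
    intro I _
    refine le_antisymm ?_ (s.le_finPartFun _)
    rintro x ⟨N, hN, hNI, hx⟩
    obtain ⟨H, hH, hHI, hNH⟩ := s.exists_fg_of_le_finPartFun I N hN hNI
    refine ⟨H, hH, hHI, ?_⟩
    have h := s.star_mono_all (I := N) (J := s.star H) hNH hx
    rwa [s.star_star_all] at h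

/-- `*` is of finite character if `* = *_f`. -/
def IsFiniteCharacter (s : StarOperation D K) : Prop :=
  s.finPart = s

/-- `*` is stable if `(I ∩ J)^* = I^* ∩ J^*` for all nonzero fractional ideals `I`, `J`. -/
def IsStable (s : StarOperation D K) : Prop :=
  ∀ I J : FractionalIdeal D⁰ K, I ≠ 0 → J ≠ 0 → s.star (I ⊓ J) = s.star I ⊓ s.star J

/-- The domain `D` is `*`-sharp. -/
def IsSharp (s : StarOperation D K) : Prop :=
  ∀ I A B : Ideal D, I ≠ ⊥ → A ≠ ⊥ → B ≠ ⊥ → A * B ≤ I →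
    ∃ H J : Ideal D, H ≠ ⊥ ∧ J ≠ ⊥ ∧
      s.star (I : FractionalIdeal D⁰ K) = s.star ((H * J : Ideal D) : FractionalIdeal D⁰ K) ∧
      (A : FractionalIdeal D⁰ K) ≤ s.star (H : FractionalIdeal D⁰ K) ∧
      (B : FractionalIdeal D⁰ K) ≤ s.star (J : FractionalIdeal D⁰ K)

/-- An integral `*`-ideal of `D`: a nonzero ideal `I` of `D` with `I^* = I`. -/
def IsStarIdeal (s : StarOperation D K) (I : Ideal D) : Prop :=
  I ≠ ⊥ ∧ s.star (I : FractionalIdeal D⁰ K) = (I : FractionalIdeal D⁰ K)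

/-- `M` is a maximal `*`-ideal: maximal among the proper integral `*`-ideals of `D`. -/
def IsMaximalStarIdeal (s : StarOperation D K) (M : Ideal D) : Prop :=
  Maximal (fun I : Ideal D => s.IsStarIdeal I ∧ I ≠ ⊤) M

/-- The `*`-dimension of `D`: the supremum of the `n` such that there is a chain
`0 ⊂ P₁ ⊂ ⋯ ⊂ Pₙ` of prime `*`-ideals `Pᵢ` of `D`. -/
noncomputable def dim (s : StarOperation D K) : ℕ∞ :=
  ⨆ (n : ℕ) (_ : ∃ P : Fin n → Ideal D, StrictMono P ∧
    ∀ i, (P i).IsPrime ∧ s.IsStarIdeal (P i)), (n : ℕ∞)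

/-- A nonzero fractional ideal `I` is `*`-invertible if `(I I⁻¹)^* = D`, where `I⁻¹ = (D : I)`. -/
def IsStarInvertible (s : StarOperation D K) (I : FractionalIdeal D⁰ K) : Prop :=
  I ≠ 0 ∧ s.star (I * I⁻¹) = 1

/-- `D` is a Prüfer `*`-multiplication domain: every nonzero finitely generated ideal of `D` is
`*_f`-invertible. -/
def IsPruferMultiplicationDomain (s : StarOperation D K) : Prop :=
  ∀ I : Ideal D, I ≠ ⊥ → I.FG → s.finPart.IsStarInvertible (I : FractionalIdeal D⁰ K)

end StarOperation

/-- The domain `A` is a valuation domain whose value group is (isomorphic, as an ordered group, to)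
a complete subgroup of the reals. Mathlib's `ValueGroup` contains an extra zero, so its group of
units is the value group, written multiplicatively and with the order reversed; the reversal is
immaterial here because `x ↦ -x` is an order-reversing automorphism of every subgroup of `ℝ`. -/
def IsValuationDomainWithCompleteRealValueGroup (A : Type*) [CommRing A] [IsDomain A] : Prop :=
  ∃ _ : ValuationRing A, ∃ G : AddSubgroup ℝ, IsComplete (G : Set ℝ) ∧
    Nonempty ((ValuationRing.ValueGroup A (FractionRing A))ˣ ≃*o Multiplicative G)

/-! Stability makes star closure invisible after localizing: if $x \in I^*$ and $M$ is a maximal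
$*$-ideal, then $dx \in I$ for some $d \notin M$, so $I^*$ and $I$ generate the same ideal of $D_M$.
Hence $D_M$ is sharp in the plain sense (`IsSharp.isSharpRing_localization`), and the main claim
concerns a local sharp domain $R$. In $R$, factoring a principal ideal $(x) \supseteq A\,((x):A)$
shows that every nonzero ideal $A$ has a gcd (`IsSharpRing.hasIdealGcd`). Factoring $(x^2,y^2)
\supseteq (x,y)(x,y)^2$ for relatively prime $x,y$ shows that one of them is a unit, so $R$ is a
valuation ring. In a valuation ring gcds of ideals are suprema in the value group, which is
therefore conditionally complete, hence archimedean, hence a complete subgroup of $\mathbb{R}$.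
Finite character puts every proper $*$-ideal inside a maximal one, so both $*$-invertibility of
finitely generated ideals and the bound on the dimension can be checked in the rings $D_M$. -/

/-! ### Conditionally complete ordered groups inside the reals. -/

section OrderedGroup

variable {G : Type*} [AddCommGroup G] [LinearOrder G] [IsOrderedAddMonoid G]

/-- If the multiples of $y > 0$ were bounded, with supremum $u$, then some $ny$ would exceed $u -
y$, and $(n+1)y$ would exceed $u$. -/
theorem archimedean_of_exists_isLUB
    (hG : ∀ S : Set G, S.Nonempty → BddAbove S → ∃ u, IsLUB S u) : Archimedean G := by
  refine ⟨fun x y hy => ?_⟩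
  by_contra! hlt
  obtain ⟨u, hu⟩ := hG (Set.range fun n : ℕ => n • y) ⟨_, 0, rfl⟩
    ⟨x, by rintro _ ⟨n, rfl⟩; exact (hlt n).le⟩
  obtain ⟨_, ⟨n, rfl⟩, hn, -⟩ := hu.exists_between (sub_lt_self u hy)
  have h : (n + 1) • y ≤ u := hu.1 ⟨n + 1, rfl⟩
  rw [succ_nsmul] at h
  exact absurd (sub_lt_iff_lt_add.mp hn) h.not_gt

/-- A conditionally complete totally ordered abelian group is a complete subgroup of `ℝ`. -/
theorem exists_complete_addSubgroup_real
    (hG : ∀ S : Set G, S.Nonempty → BddAbove S → ∃ u, IsLUB S u) :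
    ∃ H : AddSubgroup ℝ, IsComplete (H : Set ℝ) ∧ Nonempty (G ≃+o H) := by
  have := archimedean_of_exists_isLUB hG
  obtain ⟨f, hf⟩ := Archimedean.exists_orderAddMonoidHom_real_injective G
  have hmono : StrictMono f := f.monotone'.strictMono_of_injective hf
  refine ⟨(f : G →+ ℝ).range, ?_, ⟨⟨AddMonoidHom.ofInjective (f := (f : G →+ ℝ)) hf, ?_⟩⟩⟩
  · apply IsClosed.isComplete
    -- A cyclic image is discrete, hence closed. If the image is dense, each real $r$ is attained at
    -- the supremum of the elements mapped below $r$, so the image is all of $\mathbb{R}$.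
    rcases AddSubgroup.dense_or_cyclic (f : G →+ ℝ).range with hd | ⟨a, ha⟩
    · suffices h : ((f : G →+ ℝ).range : Set ℝ) = Set.univ by rw [h]; exact isClosed_univ
      refine Set.eq_univ_of_forall fun r => ?_
      have hbetween : ∀ a b : ℝ, a < b → ∃ g : G, a < f g ∧ f g < b := by
        intro a b hab
        obtain ⟨_, ⟨g, rfl⟩, hg⟩ := hd.exists_between hab
        exact ⟨g, hg⟩
      obtain ⟨g₀, -, hg₀⟩ := hbetween (r - 1) r (by linarith)
      obtain ⟨g₁, hg₁, -⟩ := hbetween r (r + 1) (by linarith)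
      obtain ⟨u, hu⟩ := hG {g | f g < r} ⟨g₀, hg₀⟩
        ⟨g₁, fun g hg => (hmono.lt_iff_lt.mp (lt_trans hg hg₁)).le⟩
      refine ⟨u, le_antisymm ?_ ?_⟩
      · by_contra! hlt
        obtain ⟨g, hg, hgu⟩ := hbetween _ _ hlt
        have : u ≤ g := hu.2 fun g' hg' => (hmono.lt_iff_lt.mp (lt_trans hg' hg)).le
        exact absurd (hmono.lt_iff_lt.mp hgu) this.not_gt
      · by_contra! hlt
        obtain ⟨g, hg, hgr⟩ := hbetween _ _ hlt
        exact absurd (hmono.lt_iff_lt.mp hg) (not_lt_of_ge (hu.1 hgr))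
    · rw [ha, ← AddSubgroup.zmultiples_eq_closure]
      exact AddSubgroup.isClosed_of_discrete
  · intro a b
    exact hmono.le_iff_le

end OrderedGroup

/-! ### Local sharp domains: gcds of ideals and the valuation property. -/

/-- Any nonzero ideal containing a product of nonzero ideals `A` and `B` is a product of ideals
containing `A` and `B`, respectively. -/
def IsSharpRing (R : Type*) [CommRing R] : Prop :=
  ∀ I A B : Ideal R, I ≠ ⊥ → A ≠ ⊥ → B ≠ ⊥ → A * B ≤ I → ∃ H J : Ideal R, I = H * J ∧ A ≤ H ∧ B ≤ J

/-- Every nonzero ideal has a greatest common divisor. -/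
def HasIdealGcd (R : Type*) [CommRing R] : Prop :=
  ∀ A : Ideal R, A ≠ ⊥ → ∃ h : R, (∀ a ∈ A, h ∣ a) ∧ ∀ y, (∀ a ∈ A, y ∣ a) → y ∣ h

theorem HasIdealGcd.exists_gcd {R : Type*} [CommRing R] (hR : HasIdealGcd R) {x : R}
    (hx : x ≠ 0) (y : R) :
    ∃ g, g ∣ x ∧ g ∣ y ∧ ∀ d, d ∣ x → d ∣ y → d ∣ g := by
  obtain ⟨g, hg, hmax⟩ := hR (Ideal.span {x, y})
    (Submodule.ne_bot_iff _ |>.mpr ⟨x, Ideal.subset_span (by simp), hx⟩)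
  refine ⟨g, hg _ (Ideal.subset_span (by simp)), hg _ (Ideal.subset_span (by simp)),
    fun d hdx hdy => hmax d fun a ha => ?_⟩
  obtain ⟨r, s, rfl⟩ := Ideal.mem_span_pair.mp ha
  exact dvd_add (hdx.mul_left r) (hdy.mul_left s)

section LocalDomain

variable {R : Type*} [CommRing R] [IsDomain R]

/-- Factors of a nonzero principal ideal are invertible, hence principal over a local ring.
Concretely, some product $hj$ is a unit times $x$: otherwise $HJ \subseteq \mathfrak{m}x$, and
cancelling $x$ puts $1$ in $\mathfrak{m}$. -/
theorem exists_generators_of_mul_eq_span_singleton [IsLocalRing R] {H J : Ideal R} {x : R}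
    (hx : x ≠ 0) (hHJ : H * J = Ideal.span {x}) :
    ∃ h j : R, h * j = x ∧ (∀ a ∈ H, h ∣ a) ∧ (∀ b ∈ J, j ∣ b) := by
  have hdvd : ∀ a ∈ H, ∀ b ∈ J, x ∣ a * b := fun a ha b hb =>
    Ideal.mem_span_singleton.mp (hHJ ▸ Ideal.mul_mem_mul ha hb)
  obtain ⟨h, hh, j, hj, u, hu⟩ : ∃ h ∈ H, ∃ j ∈ J, ∃ u : Rˣ, h * j = x * u := by
    by_contra! hno
    have hle : H * J ≤ IsLocalRing.maximalIdeal R * Ideal.span {x} := by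
      refine Ideal.mul_le.mpr fun a ha b hb => ?_
      obtain ⟨c, hc⟩ := hdvd a ha b hb
      rw [hc, mul_comm x c]
      refine Ideal.mul_mem_mul ?_ (Ideal.mem_span_singleton_self x)
      rw [IsLocalRing.mem_maximalIdeal]
      rintro ⟨u, rfl⟩
      exact hno a ha b hb u hc
    rw [hHJ, Ideal.span_singleton_le_iff_mem, Ideal.mem_mul_span_singleton] at hle
    obtain ⟨z, hz, hzx⟩ := hle
    have : z = 1 := mul_right_cancel₀ hx (by rw [hzx, one_mul])
    subst this
    exact (IsLocalRing.maximalIdeal.isMaximal R).ne_top ((Ideal.eq_top_iff_one _).mpr hz)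
  have hprod : h * (j * (↑u⁻¹ : R)) = x := by
    rw [← mul_assoc, hu, mul_assoc, Units.mul_inv, mul_one]
  have hh0 : h ≠ 0 := by rintro rfl; simp at hprod; exact hx hprod.symm
  have hj0 : j * (↑u⁻¹ : R) ≠ 0 := by intro h0; rw [h0, mul_zero] at hprod; exact hx hprod.symm
  refine ⟨h, j * (↑u⁻¹ : R), hprod, fun a ha => ?_, fun b hb => ?_⟩
  · obtain ⟨c, hc⟩ := hdvd a ha (j * (↑u⁻¹ : R)) (J.mul_mem_right _ hj)
    refine ⟨c, mul_right_cancel₀ hj0 ?_⟩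
    rw [hc, ← hprod]; ring
  · obtain ⟨c, hc⟩ := hdvd h hh b hb
    refine ⟨c, mul_left_cancel₀ hh0 ?_⟩
    rw [hc, ← hprod]; ring

/-- For $0 \ne x \in A$, factor $(x) \supseteq A\,((x):A)$ as $(h)(j)$; then $h$ divides $A$. If $y$
also divides $A$ and $x = yz$, then $z \in (x):A$, so $j \mid z$ and therefore $y \mid h$. -/
theorem IsSharpRing.hasIdealGcd [IsLocalRing R] (hR : IsSharpRing R) : HasIdealGcd R := by
  intro A hA
  obtain ⟨x, hxA, hx⟩ := Submodule.exists_mem_ne_zero_of_ne_bot hA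
  have hspan : Ideal.span {x} ≠ ⊥ := by simpa using hx
  have hcolon : ∀ z : R, z ∈ (Ideal.span {x}).colon (A : Set R) ↔ ∀ a ∈ A, x ∣ z * a := by
    intro z
    simp [Submodule.mem_colon, Ideal.mem_span_singleton]
  have hB : (Ideal.span {x}).colon (A : Set R) ≠ ⊥ :=
    Submodule.ne_bot_iff _ |>.mpr ⟨x, (hcolon x).mpr fun a _ => dvd_mul_right x a, hx⟩
  obtain ⟨H, J, hHJ, hAH, hBJ⟩ := hR (Ideal.span {x}) A _ hspan hA hB
    (Ideal.mul_le.mpr fun a ha b hb => Ideal.mem_span_singleton.mpr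
      (mul_comm b a ▸ (hcolon b).mp hb a ha))
  obtain ⟨h, j, hhj, hH, hJ⟩ := exists_generators_of_mul_eq_span_singleton hx hHJ.symm
  refine ⟨h, fun a ha => hH a (hAH ha), fun y hy => ?_⟩
  obtain ⟨z, rfl⟩ := hy x hxA
  obtain ⟨w, rfl⟩ := hJ z (hBJ ((hcolon z).mpr fun a ha => by
    rw [mul_comm]; exact mul_dvd_mul_left z (hy a ha) |>.trans (by rw [mul_comm])))
  have hj0 : j ≠ 0 := by rintro rfl; simp at hx
  exact ⟨w, mul_right_cancel₀ hj0 (by rw [hhj]; ring)⟩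

/-- Euclid's lemma: the gcd of $bx$ and $by$ is $b$ up to a unit, and $x$ divides both. -/
theorem HasIdealGcd.dvd_of_dvd_mul (hR : HasIdealGcd R) {x y b : R} (hx : x ≠ 0)
    (hxy : IsRelPrime x y) (h : x ∣ b * y) : x ∣ b := by
  by_cases hb : b = 0
  · simp [hb]
  obtain ⟨g, hgx, hgy, hmax⟩ := hR.exists_gcd (mul_ne_zero hb hx) (b * y)
  obtain ⟨k, rfl⟩ := hmax b (dvd_mul_right _ _) (dvd_mul_right _ _)
  have hk : IsUnit k := hxy ((mul_dvd_mul_iff_left hb).mp hgx) ((mul_dvd_mul_iff_left hb).mp hgy)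
  exact hk.dvd_mul_right.mp (hmax x (dvd_mul_left _ _) h)

/-- With $A = (x,y)$, sharpness factors $(x^2,y^2) \supseteq A \cdot A^2$ as $HJ$. If neither $x$
nor $y$ is a unit, then $H \subseteq \mathfrak{m}$ and $J \subseteq A^2$, so $x^2 \in
\mathfrak{m}A^2$, which forces $y$ to divide a unit. -/
theorem IsSharpRing.isUnit_of_isRelPrime [IsLocalRing R] (hR : IsSharpRing R) {x y : R}
    (hx : x ≠ 0) (hy : y ≠ 0) (hxy : IsRelPrime x y) : IsUnit x ∨ IsUnit y := by
  by_contra! hnu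
  obtain ⟨hxu, hyu⟩ := hnu
  have hgcd := hR.hasIdealGcd
  have cancel_x : ∀ b c, x * c = b * y → x ∣ b := fun b c h =>
    hgcd.dvd_of_dvd_mul hx hxy ⟨c, h.symm⟩
  have cancel_y : ∀ b c, y * c = b * x → y ∣ b := fun b c h =>
    hgcd.dvd_of_dvd_mul hy hxy.symm ⟨c, h.symm⟩
  have memA : ∀ z, z ∈ Ideal.span {x, y} ↔ ∃ a b, a * x + b * y = z := fun z =>
    Ideal.mem_span_pair
  have memI : ∀ z, z ∈ Ideal.span {x ^ 2, y ^ 2} ↔ ∃ a b, a * x ^ 2 + b * y ^ 2 = z := fun z =>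
    Ideal.mem_span_pair
  have hA : Ideal.span {x, y} ≠ ⊥ :=
    Submodule.ne_bot_iff _ |>.mpr ⟨x, Ideal.subset_span (by simp), hx⟩
  have hI : Ideal.span {x ^ 2, y ^ 2} ≠ ⊥ :=
    Submodule.ne_bot_iff _ |>.mpr ⟨x ^ 2, Ideal.subset_span (by simp), pow_ne_zero 2 hx⟩
  have memB : ∀ z, z ∈ Ideal.span {x ^ 2, x * y, y ^ 2} ↔
      ∃ a b c, z = a * x ^ 2 + b * (x * y) + c * y ^ 2 := by
    intro z
    simp only [Ideal.mem_span_insert, Ideal.mem_span_singleton']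
    constructor
    · rintro ⟨a, _, ⟨b, _, ⟨c, rfl⟩, rfl⟩, rfl⟩
      exact ⟨a, b, c, by ring⟩
    · rintro ⟨a, b, c, rfl⟩
      exact ⟨a, _, ⟨b, _, ⟨c, rfl⟩, rfl⟩, by ring⟩
  have hB : Ideal.span {x ^ 2, x * y, y ^ 2} ≠ ⊥ :=
    Submodule.ne_bot_iff _ |>.mpr ⟨x ^ 2, Ideal.subset_span (by simp), pow_ne_zero 2 hx⟩
  have hmax : ∀ a b, a * x + b * y ≠ 1 := by
    intro a b h
    have hmem : a * x + b * y ∈ IsLocalRing.maximalIdeal R :=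
      add_mem (Ideal.mul_mem_left _ _ hxu) (Ideal.mul_mem_left _ _ hyu)
    rw [h] at hmem
    exact (IsLocalRing.mem_maximalIdeal _).mp hmem isUnit_one
  obtain ⟨H, J, hHJ, hAH, hBJ⟩ := hR _ _ _ hI hA hB (Ideal.mul_le.mpr (by
    intro z hz w hw
    obtain ⟨a, b, rfl⟩ := (memA z).mp hz
    obtain ⟨c, d, e, rfl⟩ := (memB w).mp hw
    exact (memI _).mpr ⟨a * c * x + a * d * y + b * c * y, a * e * x + b * d * x + b * e * y,
      by ring⟩))
  have hprod : ∀ a ∈ H, ∀ b ∈ J, a * b ∈ Ideal.span {x ^ 2, y ^ 2} := fun a ha b hb =>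
    hHJ ▸ Ideal.mul_mem_mul ha hb
  have hxH : x ∈ H := hAH (Ideal.subset_span (by simp))
  have hyH : y ∈ H := hAH (Ideal.subset_span (by simp))
  have hxyJ : x * y ∈ J := hBJ (Ideal.subset_span (by simp))
  -- If $H = R$ then $xy = ax^2 + by^2$; here $y \mid a$ and $x \mid b$, and cancelling $xy$ gives
  -- $1 \in (x,y)$.
  have hHmax : H ≤ IsLocalRing.maximalIdeal R := by
    refine IsLocalRing.le_maximalIdeal fun htop => ?_
    obtain ⟨a, b, hab⟩ := (memI _).mp (hprod 1 (htop ▸ Submodule.mem_top) _ hxyJ)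
    obtain ⟨c', hc'⟩ := cancel_y (a * x) (x - b * y) (by linear_combination -hab)
    obtain ⟨c, rfl⟩ := cancel_y a c' hc'.symm
    obtain ⟨d, rfl⟩ := cancel_x b (1 - c * x)
      (mul_right_cancel₀ hy (by linear_combination -hab))
    exact hmax c d (mul_right_cancel₀ (mul_ne_zero hx hy) (by linear_combination hab))
  -- Both $xz$ and $yz$ lie in $(x^2,y^2)$. Cancelling $x$ and $y$ gives two expressions for $z$,
  -- and comparing them produces the coefficient $e$ of $xy$.
  have hJ : J ≤ Ideal.span {x ^ 2, x * y, y ^ 2} := by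
    intro z hz
    obtain ⟨a, b, hab⟩ := (memI _).mp (hprod x hxH z hz)
    obtain ⟨c, d, hcd⟩ := (memI _).mp (hprod y hyH z hz)
    obtain ⟨b', rfl⟩ : x ∣ b := by
      obtain ⟨b', h⟩ := cancel_x (b * y) (z - a * x) (by linear_combination -hab)
      exact cancel_x b b' h.symm
    obtain ⟨c', rfl⟩ : y ∣ c := by
      obtain ⟨c', h⟩ := cancel_y (c * x) (z - d * y) (by linear_combination -hcd)
      exact cancel_y c c' h.symm
    have h₁ : z = a * x + b' * y ^ 2 := mul_left_cancel₀ hx (by linear_combination -hab)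
    have h₂ : z = c' * x ^ 2 + d * y := mul_left_cancel₀ hy (by linear_combination -hcd)
    obtain ⟨e, he⟩ := cancel_y (a - c' * x) (d - b' * y) (by linear_combination h₁ - h₂)
    exact (memB z).mpr ⟨c', e, b', by linear_combination h₁ + x * he⟩
  have hle : Ideal.span {x ^ 2, y ^ 2} ≤
      IsLocalRing.maximalIdeal R * Ideal.span {x ^ 2, x * y, y ^ 2} :=
    hHJ.le.trans (Ideal.mul_mono hHmax hJ)
  have hform : ∀ z ∈ IsLocalRing.maximalIdeal R * Ideal.span {x ^ 2, x * y, y ^ 2},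
      ∃ m ∈ IsLocalRing.maximalIdeal R, ∃ w, z = m * x ^ 2 + w * y := by
    intro z hz
    induction hz using Submodule.mul_induction_on' with
    | mem_mul_mem m hm w hw =>
      obtain ⟨a, b, c, rfl⟩ := (memB w).mp hw
      exact ⟨m * a, Ideal.mul_mem_right _ _ hm, m * b * x + m * c * y, by ring⟩
    | add z _ z' _ h h' =>
      obtain ⟨m, hm, w, rfl⟩ := h
      obtain ⟨m', hm', w', rfl⟩ := h'
      exact ⟨m + m', add_mem hm hm', w + w', by ring⟩
  -- Now $(1-m)x^2 = wy$ with $1-m$ a unit, and Euclid's lemma removes the two factors $x$ in turn.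
  obtain ⟨m, hm, w, hw⟩ := hform _ (hle (Ideal.subset_span (by simp : x ^ 2 ∈ _)))
  have hu : IsUnit (1 - m) := by
    by_contra hnu
    have := add_mem ((IsLocalRing.mem_maximalIdeal _).mpr hnu) hm
    rw [sub_add_cancel] at this
    exact (IsLocalRing.mem_maximalIdeal _).mp this isUnit_one
  obtain ⟨k, hk⟩ := cancel_y ((1 - m) * x) w (by linear_combination -hw)
  obtain ⟨k', hk'⟩ := cancel_y (1 - m) k hk.symm
  exact hyu (isUnit_of_mul_isUnit_left (hk' ▸ hu))

theorem IsSharpRing.valuationRing [IsLocalRing R] (hR : IsSharpRing R) : ValuationRing R := by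
  refine { cond' := fun a b => ?_ }
  by_cases ha : a = 0
  · exact ⟨0, Or.inr (by simp [ha])⟩
  by_cases hb : b = 0
  · exact ⟨0, Or.inl (by simp [hb])⟩
  obtain ⟨g, ⟨x, rfl⟩, ⟨y, rfl⟩, hmax⟩ := hR.hasIdealGcd.exists_gcd ha b
  have hg : g ≠ 0 := left_ne_zero_of_mul ha
  have hxy : IsRelPrime x y := by
    intro d hdx hdy
    have h : g * d ∣ g * 1 := by
      simpa using hmax (g * d) (mul_dvd_mul_left g hdx) (mul_dvd_mul_left g hdy)
    exact isUnit_iff_dvd_one.mpr ((mul_dvd_mul_iff_left hg).mp h)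
  rcases hR.isUnit_of_isRelPrime (right_ne_zero_of_mul ha) (right_ne_zero_of_mul hb) hxy with h | h
  · obtain ⟨c, hc⟩ := h.dvd (a := y)
    exact ⟨c, Or.inl (by rw [hc]; ring)⟩
  · obtain ⟨c, hc⟩ := h.dvd (a := x)
    exact ⟨c, Or.inr (by rw [hc]; ring)⟩

/-- A ring in which ideals have greatest common divisors is archimedean. -/
theorem HasIdealGcd.exists_not_pow_dvd (hR : HasIdealGcd R) {p q : R} (hp : p ≠ 0)
    (hq : ¬ IsUnit q) : ∃ n : ℕ, ¬ q ^ n ∣ p := by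
  by_contra! hdvd
  have hq0 : q ≠ 0 := by rintro rfl; simpa [hp] using hdvd 1
  have hmem : ∀ a, a ∈ (⨅ n : ℕ, Ideal.span {q ^ n}) ↔ ∀ n : ℕ, q ^ n ∣ a := by
    simp [Ideal.mem_span_singleton]
  -- The gcd $h$ of $\bigcap_n (q^n)$ is divisible by every $q^n$. So $h = qk$ with $k$ again in the
  -- intersection, whence $h \mid k$ and $q$ is a unit.
  obtain ⟨h, hh, hmax⟩ := hR (⨅ n : ℕ, Ideal.span {q ^ n})
    (Submodule.ne_bot_iff _ |>.mpr ⟨p, (hmem p).mpr hdvd, hp⟩)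
  have hqh : ∀ n : ℕ, q ^ n ∣ h := fun n => hmax _ fun a ha => (hmem a).mp ha n
  have hh0 : h ≠ 0 := by
    rintro rfl
    exact hp (zero_dvd_iff.mp (hh p ((hmem p).mpr hdvd)))
  obtain ⟨k, rfl⟩ : q ∣ h := by simpa using hqh 1
  obtain ⟨c, hc⟩ := hh k ((hmem k).mpr fun n => (mul_dvd_mul_iff_left hq0).mp (by
    simpa [pow_succ'] using hqh (n + 1)))
  refine hq (IsUnit.of_mul_eq_one c (mul_right_cancel₀ (right_ne_zero_of_mul hh0) ?_))
  linear_combination -hc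

end LocalDomain

/-! ### Suprema in the value group from gcds of ideals. -/

section ValueGroup

variable {R : Type*} [CommRing R] [IsDomain R] [ValuationRing R]
  {F : Type*} [Field F] [Algebra R F] [IsFractionRing R F]

theorem ValuationRing.valuation_algebraMap_le_iff (a b : R) :
    ValuationRing.valuation R F (algebraMap R F a) ≤ ValuationRing.valuation R F (algebraMap R F b)
      ↔ b ∣ a := by
  change (∃ c : R, c • algebraMap R F b = algebraMap R F a) ↔ _
  simp only [Algebra.smul_def, ← map_mul, (IsFractionRing.injective R F).eq_iff]
  exact ⟨fun ⟨c, h⟩ => ⟨c, by rw [← h, mul_comm]⟩, fun ⟨c, h⟩ => ⟨c, by rw [h, mul_comm]⟩⟩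

theorem ValuationRing.exists_valuation_algebraMap_eq {g : ValuationRing.ValueGroup R F}
    (hg : g ≤ 1) : ∃ r : R, ValuationRing.valuation R F (algebraMap R F r) = g := by
  obtain ⟨x, rfl⟩ : ∃ x, ValuationRing.valuation R F x = g := by
    induction g using Quotient.inductionOn' with
    | h x => exact ⟨x, rfl⟩
  obtain ⟨r, rfl⟩ := (ValuationRing.mem_integer_iff R F x).mp hg
  exact ⟨r, rfl⟩

/-- Since $v(a) \le v(b)$ means $b \mid a$, a gcd $h$ of an ideal gives the least upper bound $v(h)$
of its values among values of ring elements. Dividing by an upper bound $u$ moves $S$ into the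
values of $R$, where it generates the ideal $A$; the supremum is $v(h)u$. -/
theorem HasIdealGcd.exists_isLUB_units_valueGroup (hR : HasIdealGcd R)
    (S : Set (ValuationRing.ValueGroup R F)ˣ) (hS : S.Nonempty) (hbdd : BddAbove S) :
    ∃ u, IsLUB S u := by
  obtain ⟨u, hu⟩ := hbdd
  let v := ValuationRing.valuation R F
  have hv1 : ∀ r : R, v (algebraMap R F r) ≤ 1 := fun r =>
    (ValuationRing.mem_integer_iff R F _).mpr ⟨r, rfl⟩
  let A : Ideal R :=
    { carrier := {r | ∃ s ∈ S, v (algebraMap R F r) * u ≤ s}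
      zero_mem' := by
        obtain ⟨s, hs⟩ := hS
        exact ⟨s, hs, by simp⟩
      add_mem' := by
        rintro a b ⟨s, hs, ha⟩ ⟨t, ht, hb⟩
        rcases le_total (v (algebraMap R F a)) (v (algebraMap R F b)) with h | h
        · refine ⟨t, ht, le_trans (mul_le_mul_left ?_ _) hb⟩
          rw [map_add]
          exact (v.map_add _ _).trans (max_le h le_rfl)
        · refine ⟨s, hs, le_trans (mul_le_mul_left ?_ _) ha⟩
          rw [map_add]
          exact (v.map_add _ _).trans (max_le le_rfl h)
      smul_mem' := by
        rintro c a ⟨s, hs, ha⟩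
        refine ⟨s, hs, le_trans (mul_le_mul_left ?_ _) ha⟩
        rw [smul_eq_mul, map_mul, map_mul]
        exact mul_le_of_le_one_left' (hv1 c) }
  have hrep : ∀ s ∈ S, ∃ r ∈ A, v (algebraMap R F r) * u = s := by
    intro s hs
    have hle : ((s * u⁻¹ : (ValuationRing.ValueGroup R F)ˣ) : ValuationRing.ValueGroup R F) ≤ 1 := by
      rw [← Units.val_one, Units.val_le_val]
      exact mul_inv_le_one_iff_le.mpr (hu hs)
    obtain ⟨r, hr⟩ := ValuationRing.exists_valuation_algebraMap_eq hle
    have : v (algebraMap R F r) * u = s := by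
      rw [show v (algebraMap R F r) = _ from hr]; simp
    exact ⟨r, ⟨s, hs, this.le⟩, this⟩
  have hA : A ≠ ⊥ := by
    obtain ⟨s, hs⟩ := hS
    obtain ⟨r, hr, h⟩ := hrep s hs
    refine Submodule.ne_bot_iff _ |>.mpr ⟨r, hr, ?_⟩
    rintro rfl
    exact s.ne_zero (by simpa using h.symm)
  obtain ⟨h, hh, hmax⟩ := hR A hA
  have hh0 : v (algebraMap R F h) ≠ 0 := by
    rw [Ne, map_eq_zero, IsFractionRing.to_map_eq_zero_iff]
    rintro rfl
    exact hA (by rw [eq_bot_iff]; exact fun a ha => zero_dvd_iff.mp (hh a ha))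
  refine ⟨Units.mk0 _ hh0 * u, fun s hs => ?_, fun w hw => ?_⟩
  · obtain ⟨r, hr, hrs⟩ := hrep s hs
    rw [← Units.val_le_val, ← hrs, Units.val_mul, Units.val_mk0]
    exact mul_le_mul_left ((ValuationRing.valuation_algebraMap_le_iff r h).mpr (hh r hr)) _
  · rw [← Units.val_le_val, Units.val_mul, Units.val_mk0]
    -- Only bounds $w \le u$ have the form $v(y)u$ with $y \in R$; those above $u$ are immediate
    -- from $v(h) \le 1$.
    rcases le_total u w with huw | hwu
    · exact (mul_le_of_le_one_left' (hv1 h)).trans (Units.val_le_val.mpr huw)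
    · have hle : ((w * u⁻¹ : (ValuationRing.ValueGroup R F)ˣ) : ValuationRing.ValueGroup R F)
          ≤ 1 := by
        rw [← Units.val_one, Units.val_le_val]
        exact mul_inv_le_one_iff_le.mpr hwu
      obtain ⟨y, hy⟩ := ValuationRing.exists_valuation_algebraMap_eq hle
      have hyw : v (algebraMap R F y) * u = w := by
        rw [show v (algebraMap R F y) = _ from hy]; simp
      rw [← hyw]
      refine mul_le_mul_left ((ValuationRing.valuation_algebraMap_le_iff h y).mpr (hmax y ?_)) _
      rintro a ⟨s, hs, ha⟩
      rw [← ValuationRing.valuation_algebraMap_le_iff (F := F)]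
      have : v (algebraMap R F a) * u ≤ v (algebraMap R F y) * u :=
        hyw ▸ ha.trans (Units.val_le_val.mpr (hw hs))
      exact (mul_le_mul_iff_left₀ (zero_lt_iff.mpr u.ne_zero)).mp this

end ValueGroup

theorem IsSharpRing.isValuationDomainWithCompleteRealValueGroup {R : Type*} [CommRing R]
    [IsDomain R] [IsLocalRing R] (hR : IsSharpRing R) :
    IsValuationDomainWithCompleteRealValueGroup R := by
  have := hR.valuationRing
  obtain ⟨H, hH, ⟨e⟩⟩ := exists_complete_addSubgroup_real
    (G := Additive (ValuationRing.ValueGroup R (FractionRing R))ˣ)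
    (hR.hasIdealGcd.exists_isLUB_units_valueGroup (F := FractionRing R))
  exact ⟨this, H, hH, ⟨OrderAddMonoidIso.toMultiplicativeRight e⟩⟩

/-! ### Maximal $*$-ideals and descent of sharpness to the localization. -/

namespace StarOperation

variable {D K : Type*} [CommRing D] [IsDomain D] [Field K] [Algebra D K] [IsFractionRing D K]

theorem star_coeIdeal_le_one (s : StarOperation D K) (I : Ideal D) :
    s.star (I : FractionalIdeal D⁰ K) ≤ 1 :=
  (s.star_mono_all FractionalIdeal.coeIdeal_le_one).trans s.star_one.le

/-- The star closure of an integral ideal is an integral ideal. -/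
theorem exists_coeIdeal_eq_star (s : StarOperation D K) (I : Ideal D) :
    ∃ I' : Ideal D, (I' : FractionalIdeal D⁰ K) = s.star (I : FractionalIdeal D⁰ K) ∧ I ≤ I' := by
  obtain ⟨I', hI'⟩ := FractionalIdeal.le_one_iff_exists_coeIdeal.mp (s.star_coeIdeal_le_one I)
  refine ⟨I', hI', (FractionalIdeal.coeIdeal_le_coeIdeal K).mp ?_⟩
  rw [hI']
  exact s.le_star_all _

theorem isStarIdeal_of_coeIdeal_eq_star (s : StarOperation D K) {I I' : Ideal D} (hI : I ≠ ⊥)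
    (hle : I ≤ I') (h : (I' : FractionalIdeal D⁰ K) = s.star (I : FractionalIdeal D⁰ K)) :
    s.IsStarIdeal I' :=
  ⟨fun h' => hI (le_bot_iff.mp (h' ▸ hle)), by rw [h, s.star_star_all]⟩

theorem IsMaximalStarIdeal.star_eq_one {s : StarOperation D K} {M I : Ideal D}
    (hM : s.IsMaximalStarIdeal M) (hlt : M < I) : s.star (I : FractionalIdeal D⁰ K) = 1 := by
  obtain ⟨I', hI', hle⟩ := s.exists_coeIdeal_eq_star I
  have hI : I ≠ ⊥ := (bot_le.trans_lt hlt).ne'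
  have htop : I' = ⊤ := by
    by_contra hne
    exact (hlt.trans_le hle).not_ge
      (hM.2 ⟨s.isStarIdeal_of_coeIdeal_eq_star hI hle hI', hne⟩ (hlt.le.trans hle))
  rw [← hI', htop, FractionalIdeal.coeIdeal_top]

/-- If $ab \in M$ and $a \notin M$, then $(M + aD)^* = D$, so $bD = (bM + abD)^* \subseteq M^* = M$.
-/
theorem IsMaximalStarIdeal.isPrime {s : StarOperation D K} {M : Ideal D}
    (hM : s.IsMaximalStarIdeal M) : M.IsPrime := by
  refine ⟨hM.1.2, fun {a b} hab => or_iff_not_imp_left.mpr fun ha => ?_⟩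
  by_cases hb : b = 0
  · rw [hb]; exact M.zero_mem
  have hlt : M < M ⊔ Ideal.span {a} :=
    lt_of_le_of_ne le_sup_left fun h => ha (h ▸ Ideal.mem_sup_right (Ideal.mem_span_singleton_self a))
  have hbK : algebraMap D K b ≠ 0 := by simpa using hb
  have h := s.star_smul_all hbK ((M ⊔ Ideal.span {a} : Ideal D) : FractionalIdeal D⁰ K)
  rw [hM.star_eq_one hlt, mul_one] at h
  have hle : FractionalIdeal.spanSingleton D⁰ (algebraMap D K b) *
      ((M ⊔ Ideal.span {a} : Ideal D) : FractionalIdeal D⁰ K) ≤ (M : FractionalIdeal D⁰ K) := by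
    rw [← FractionalIdeal.coeIdeal_span_singleton, ← FractionalIdeal.coeIdeal_mul,
      FractionalIdeal.coeIdeal_le_coeIdeal, Ideal.span_singleton_mul_le_iff]
    intro z hz
    obtain ⟨m, hm, w, hw, rfl⟩ := Submodule.mem_sup.mp hz
    obtain ⟨c, rfl⟩ := Ideal.mem_span_singleton.mp hw
    rw [mul_add, ← mul_assoc, mul_comm b a]
    exact add_mem (M.mul_mem_left _ hm) (M.mul_mem_right _ hab)
  have hmem : algebraMap D K b ∈ (M : FractionalIdeal D⁰ K) := by
    rw [← hM.1.1.2]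
    exact s.star_mono_all hle (h.ge (FractionalIdeal.mem_spanSingleton_self D⁰ _))
  obtain ⟨m, hm, hmb⟩ := (FractionalIdeal.mem_coeIdeal D⁰).mp hmem
  rwa [← IsFractionRing.injective D K hmb]

/-- A nonzero ideal with proper star closure lies in a maximal `*`-ideal. -/
theorem exists_isMaximalStarIdeal_ge (s : StarOperation D K) (hfin : s.IsFiniteCharacter)
    {I : Ideal D} (hI : I ≠ ⊥) (hne : s.star (I : FractionalIdeal D⁰ K) ≠ 1) :
    ∃ M, I ≤ M ∧ s.IsMaximalStarIdeal M := by
  obtain ⟨I', hI', hle⟩ := s.exists_coeIdeal_eq_star I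
  have htop : I' ≠ ⊤ := by
    rintro rfl
    exact hne (by rw [← hI', FractionalIdeal.coeIdeal_top])
  suffices hzorn : ∀ c ⊆ {J : Ideal D | s.IsStarIdeal J ∧ J ≠ ⊤}, IsChain (· ≤ ·) c → ∀ J₀ ∈ c,
      ∃ ub ∈ {J : Ideal D | s.IsStarIdeal J ∧ J ≠ ⊤}, ∀ z ∈ c, z ≤ ub by
    obtain ⟨M, hM, hmax⟩ := zorn_le_nonempty₀ _ hzorn I'
      ⟨s.isStarIdeal_of_coeIdeal_eq_star hI hle hI', htop⟩
    exact ⟨M, hle.trans hM, hmax⟩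
  intro c hc hchain J₀ hJ₀
  have hdir : DirectedOn (· ≤ ·) c := hchain.directedOn
  have hmem : ∀ x, x ∈ sSup c ↔ ∃ J ∈ c, x ∈ J := fun x =>
    Submodule.mem_sSup_of_directed ⟨J₀, hJ₀⟩ hdir
  refine ⟨sSup c, ⟨⟨?_, le_antisymm ?_ (s.le_star_all _)⟩, ?_⟩, fun z hz => le_sSup hz⟩
  · exact fun h => (hc hJ₀).1.1 (le_bot_iff.mp (h ▸ le_sSup hJ₀))
  -- Finite character makes the union of the chain a $*$-ideal: a finitely generated $H$ inside the
  -- union lies in a single member of the chain.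
  · have hf : s.star ((sSup c : Ideal D) : FractionalIdeal D⁰ K) =
        s.finPartFun ((sSup c : Ideal D) : FractionalIdeal D⁰ K) :=
      congrArg (fun t : StarOperation D K => t.star _) hfin.symm
    rw [hf]
    rintro x ⟨H, hH, hHle, hx⟩
    obtain ⟨J, hJ, hHJ⟩ : ∃ J ∈ c, (H : Submodule D K) ≤
        ((J : FractionalIdeal D⁰ K) : Submodule D K) := by
      have hHle' : (H : Submodule D K) ≤
        (((sSup c : Ideal D) : FractionalIdeal D⁰ K) : Submodule D K) := hHle
      generalize (H : Submodule D K) = N at hH hHle'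
      clear hx hHle
      induction N, hH using Submodule.fg_induction with
      | singleton y =>
        obtain ⟨d, hd, rfl⟩ := (FractionalIdeal.mem_coeIdeal D⁰).mp
          (hHle' (Submodule.mem_span_singleton_self y))
        obtain ⟨J, hJ, hdJ⟩ := (hmem d).mp hd
        refine ⟨J, hJ, ?_⟩
        rw [Submodule.span_singleton_le_iff_mem]
        exact FractionalIdeal.mem_coeIdeal_of_mem D⁰ hdJ
      | sup N₁ N₂ _ _ h₁ h₂ =>
        obtain ⟨J₁, hJ₁, hN₁⟩ := h₁ (le_sup_left.trans hHle')
        obtain ⟨J₂, hJ₂, hN₂⟩ := h₂ (le_sup_right.trans hHle')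
        obtain ⟨J, hJ, hle₁, hle₂⟩ := hdir J₁ hJ₁ J₂ hJ₂
        exact ⟨J, hJ, sup_le (hN₁.trans ((FractionalIdeal.coeIdeal_le_coeIdeal K).mpr hle₁))
          (hN₂.trans ((FractionalIdeal.coeIdeal_le_coeIdeal K).mpr hle₂))⟩
    have hxJ : x ∈ (J : FractionalIdeal D⁰ K) := by
      rw [← (hc hJ).1.2]
      exact s.star_mono_all (J := (J : FractionalIdeal D⁰ K)) hHJ hx
    exact (FractionalIdeal.coeIdeal_le_coeIdeal K).mpr (le_sSup hJ) hxJ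
  · rw [Ne, Ideal.eq_top_iff_one, hmem]
    rintro ⟨J, hJ, h1⟩
    exact (hc hJ).2 ((Ideal.eq_top_iff_one J).mpr h1)

/-- For stable `*`, an element of `I^*` is multiplied into `I` by an element outside `M`. -/
theorem IsStable.exists_notMem_mul_mem {s : StarOperation D K} (hstable : s.IsStable)
    {M : Ideal D} (hM : s.IsMaximalStarIdeal M) {I : Ideal D} (hI : I ≠ ⊥) {x : D}
    (hx : algebraMap D K x ∈ s.star (I : FractionalIdeal D⁰ K)) : ∃ d ∉ M, d * x ∈ I := by
  by_cases hx0 : x = 0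
  · exact ⟨1, fun h => hM.1.2 ((Ideal.eq_top_iff_one M).mpr h), by simp [hx0]⟩
  by_contra! hno
  have hxK : algebraMap D K x ≠ 0 := by simpa using hx0
  -- $T = x^{-1}I$, so $T \cap D$ is the colon ideal $(I : x)$. By stability its closure is
  -- $x^{-1}I^* \cap D = D$, so it cannot lie in $M$.
  let T := FractionalIdeal.spanSingleton D⁰ (algebraMap D K x)⁻¹ * (I : FractionalIdeal D⁰ K)
  have hT0 : T ≠ 0 := by
    intro hT
    refine FractionalIdeal.coeIdeal_ne_zero (K := K) |>.mpr hI ?_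
    rw [← one_mul (I : FractionalIdeal D⁰ K), ← FractionalIdeal.spanSingleton_one,
      ← mul_inv_cancel₀ hxK, ← FractionalIdeal.spanSingleton_mul_spanSingleton, mul_assoc]
    exact (congrArg _ hT).trans (mul_zero _)
  have hle : T ⊓ 1 ≤ (M : FractionalIdeal D⁰ K) := by
    rintro y ⟨hy, hy1⟩
    obtain ⟨d, rfl⟩ := (FractionalIdeal.mem_one_iff D⁰).mp hy1
    obtain ⟨z, hz, hdz⟩ := FractionalIdeal.mem_singleton_mul.mp hy
    obtain ⟨i, hi, rfl⟩ := (FractionalIdeal.mem_coeIdeal D⁰).mp hz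
    refine FractionalIdeal.mem_coeIdeal_of_mem D⁰ ?_
    by_contra hd
    refine hno d hd ?_
    have : d * x = i := IsFractionRing.injective D K (by
      rw [map_mul, hdz]; field_simp)
    rwa [this]
  have hone : (1 : FractionalIdeal D⁰ K) ≤ s.star (T ⊓ 1) := by
    rw [hstable T 1 hT0 one_ne_zero, s.star_one, s.star_smul_all (inv_ne_zero hxK)]
    refine le_inf ?_ le_rfl
    rw [← FractionalIdeal.spanSingleton_one, FractionalIdeal.spanSingleton_le_iff_mem]
    exact FractionalIdeal.mem_singleton_mul.mpr ⟨_, hx, (inv_mul_cancel₀ hxK).symm⟩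
  have h1 : (1 : FractionalIdeal D⁰ K) ≤ (M : FractionalIdeal D⁰ K) :=
    hone.trans ((s.star_mono_all hle).trans hM.1.1.2.le)
  rw [← FractionalIdeal.coeIdeal_top, FractionalIdeal.coeIdeal_le_coeIdeal] at h1
  exact hM.1.2 (top_le_iff.mp h1)

theorem IsStable.map_le_map {s : StarOperation D K} (hstable : s.IsStable)
    {M : Ideal D} (hM : s.IsMaximalStarIdeal M) [M.IsPrime] {I J : Ideal D} (hJ : J ≠ ⊥)
    (h : (I : FractionalIdeal D⁰ K) ≤ s.star (J : FractionalIdeal D⁰ K)) :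
    I.map (algebraMap D (Localization.AtPrime M)) ≤
      J.map (algebraMap D (Localization.AtPrime M)) := by
  refine Ideal.map_le_iff_le_comap.mpr fun x hx => ?_
  obtain ⟨d, hd, hdx⟩ := hstable.exists_notMem_mul_mem hM hJ
    (h (FractionalIdeal.mem_coeIdeal_of_mem D⁰ hx))
  exact (IsLocalization.algebraMap_mem_map_algebraMap_iff M.primeCompl _ _ _).mpr ⟨d, hd, hdx⟩

/-- Contract the ideals to $D$, factor there up to star closure, and extend back:
`IsStable.map_le_map` discards the closures. -/
theorem IsSharp.isSharpRing_localization {s : StarOperation D K} (hsharp : s.IsSharp)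
    (hstable : s.IsStable) {M : Ideal D} (hM : s.IsMaximalStarIdeal M) [M.IsPrime] :
    IsSharpRing (Localization.AtPrime M) := by
  intro I A B hI hA hB hAB
  have hmc : ∀ X : Ideal (Localization.AtPrime M),
      (X.comap (algebraMap D _)).map (algebraMap D (Localization.AtPrime M)) = X :=
    IsLocalization.map_under M.primeCompl _
  have hne : ∀ X : Ideal (Localization.AtPrime M), X ≠ ⊥ → X.comap (algebraMap D _) ≠ ⊥ := by
    intro X hX h
    exact hX (by rw [← hmc X, h, Ideal.map_bot])
  obtain ⟨H, J, hH, hJ, hstar, hAH, hBJ⟩ := hsharp _ _ _ (hne I hI) (hne A hA) (hne B hB)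
    ((Ideal.le_comap_mul _).trans (Ideal.comap_mono hAB))
  refine ⟨H.map (algebraMap D _), J.map (algebraMap D _), ?_, ?_, ?_⟩
  · rw [← Ideal.map_mul, ← hmc I]
    exact le_antisymm
      (hstable.map_le_map hM (mul_ne_zero hH hJ) ((s.le_star_all _).trans hstar.le))
      (hstable.map_le_map hM (hne I hI) ((s.le_star_all _).trans hstar.ge))
  · rw [← hmc A]; exact hstable.map_le_map hM hH hAH
  · rw [← hmc B]; exact hstable.map_le_map hM hJ hBJ

end StarOperation

/-! ### Clearing denominators at a prime. -/

section Localization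

variable {D : Type*} [CommRing D] (M : Ideal D) [M.IsPrime]

theorem exists_notMem_dvd_mul_of_dvd_localization {a b : D}
    (h : algebraMap D (Localization.AtPrime M) a ∣ algebraMap D (Localization.AtPrime M) b) :
    ∃ d ∉ M, a ∣ d * b := by
  have hmem : algebraMap D (Localization.AtPrime M) b ∈
      (Ideal.span {a}).map (algebraMap D (Localization.AtPrime M)) := by
    rwa [Ideal.map_span, Set.image_singleton, Ideal.mem_span_singleton]
  obtain ⟨d, hd, hdb⟩ :=
    (IsLocalization.algebraMap_mem_map_algebraMap_iff M.primeCompl _ _ _).mp hmem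
  exact ⟨d, hd, Ideal.mem_span_singleton.mp hdb⟩

/-- Over the valuation ring $D_M$ one of the finitely many generators of $I$ divides the others. The
product of the denominators involved stays outside the prime $M$. -/
theorem Ideal.FG.exists_notMem_forall_dvd_mul [IsDomain D]
    [ValuationRing (Localization.AtPrime M)]
    {I : Ideal D} (hI : I.FG) : ∃ a ∈ I, ∃ d ∉ M, ∀ x ∈ I, a ∣ d * x := by
  induction I, hI using Submodule.fg_induction with
  | singleton x =>
    refine ⟨x, Ideal.mem_span_singleton_self x, 1, fun h =>
      Ideal.IsPrime.ne_top ‹_› ((Ideal.eq_top_iff_one M).mpr h), fun y hy => ?_⟩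
    rw [one_mul]
    exact Ideal.mem_span_singleton.mp hy
  | sup I₁ I₂ _ _ h₁ h₂ =>
    obtain ⟨a₁, ha₁, d₁, hd₁, h₁⟩ := h₁
    obtain ⟨a₂, ha₂, d₂, hd₂, h₂⟩ := h₂
    have key : ∀ a d, (a = a₁ ∨ a = a₂) → d ∉ M → (a ∣ d * a₁) → (a ∣ d * a₂) →
        ∃ a ∈ I₁ ⊔ I₂, ∃ d ∉ M, ∀ x ∈ I₁ ⊔ I₂, a ∣ d * x := by
      intro a d ha hd hda₁ hda₂
      refine ⟨a, ?_, d * (d₁ * d₂), ?_, fun x hx => ?_⟩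
      · rcases ha with rfl | rfl
        · exact Submodule.mem_sup_left ha₁
        · exact Submodule.mem_sup_right ha₂
      · exact M.primeCompl.mul_mem hd (M.primeCompl.mul_mem hd₁ hd₂)
      · obtain ⟨y, hy, z, hz, rfl⟩ := Submodule.mem_sup.mp hx
        obtain ⟨c₁, hc₁⟩ := h₁ y hy
        obtain ⟨c₂, hc₂⟩ := h₂ z hz
        have : d * (d₁ * d₂) * (y + z) = d * a₁ * (d₂ * c₁) + d * a₂ * (d₁ * c₂) := by
          linear_combination d * d₂ * hc₁ + d * d₁ * hc₂
        rw [this]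
        exact dvd_add (hda₁.mul_right _) (hda₂.mul_right _)
    rcases ValuationRing.dvd_total (algebraMap D (Localization.AtPrime M) a₁)
      (algebraMap D (Localization.AtPrime M) a₂) with h | h
    · obtain ⟨d, hd, hdvd⟩ := exists_notMem_dvd_mul_of_dvd_localization M h
      exact key a₁ d (Or.inl rfl) hd (dvd_mul_left _ _) hdvd
    · obtain ⟨d, hd, hdvd⟩ := exists_notMem_dvd_mul_of_dvd_localization M h
      exact key a₂ d (Or.inr rfl) hd hdvd (dvd_mul_left _ _)

end Localization

/-! ### The P$*$MD property and the dimension bound. -/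

namespace StarOperation

variable {D K : Type*} [CommRing D] [IsDomain D] [Field K] [Algebra D K] [IsFractionRing D K]

theorem IsSharp.isPruferMultiplicationDomain {s : StarOperation D K} (hsharp : s.IsSharp)
    (hfin : s.IsFiniteCharacter) (hstable : s.IsStable) : s.IsPruferMultiplicationDomain := by
  intro I hI hfg
  have hI0 : (I : FractionalIdeal D⁰ K) ≠ 0 := FractionalIdeal.coeIdeal_ne_zero.mpr hI
  rw [hfin]
  refine ⟨hI0, ?_⟩
  by_contra hne
  have hle : (I : FractionalIdeal D⁰ K) * (I : FractionalIdeal D⁰ K)⁻¹ ≤ 1 :=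
    FractionalIdeal.mul_one_div_le_one
  obtain ⟨N, hN⟩ := FractionalIdeal.le_one_iff_exists_coeIdeal.mp hle
  have hIN : I ≤ N := (FractionalIdeal.coeIdeal_le_coeIdeal K).mp
    (hN ▸ FractionalIdeal.le_self_mul_inv FractionalIdeal.coeIdeal_le_one)
  rw [← hN] at hne
  obtain ⟨M, hNM, hM⟩ := s.exists_isMaximalStarIdeal_ge hfin
    (fun h => hI (le_bot_iff.mp (h ▸ hIN))) hne
  have := hM.isPrime
  have := (hsharp.isSharpRing_localization hstable hM).valuationRing
  obtain ⟨a, ha, d, hd, hdvd⟩ := hfg.exists_notMem_forall_dvd_mul M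
  have ha0 : a ≠ 0 := by
    rintro rfl
    refine hI (le_bot_iff.mp fun x hx => ?_)
    exact (mul_eq_zero.mp (zero_dvd_iff.mp (hdvd x hx))).resolve_left
      fun h => hd (h ▸ M.zero_mem)
  have haK : algebraMap D K a ≠ 0 := by simpa using ha0
  -- From $dI \subseteq aD$ we get $d/a \in I^{-1}$, so $d = a \cdot (d/a)$ lies in $II^{-1}
  -- \subseteq M$, a contradiction.
  have hinv : algebraMap D K d * (algebraMap D K a)⁻¹ ∈ (I : FractionalIdeal D⁰ K)⁻¹ := by
    rw [FractionalIdeal.mem_inv_iff hI0]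
    intro y hy
    obtain ⟨x, hx, rfl⟩ := (FractionalIdeal.mem_coeIdeal D⁰).mp hy
    obtain ⟨c, hc⟩ := hdvd x hx
    refine (FractionalIdeal.mem_one_iff D⁰).mpr ⟨c, ?_⟩
    have := congrArg (algebraMap D K) hc
    rw [map_mul, map_mul] at this
    field_simp
    linear_combination -this
  have hdN : algebraMap D K d ∈ (N : FractionalIdeal D⁰ K) := by
    rw [hN]
    convert FractionalIdeal.mul_mem_mul (FractionalIdeal.mem_coeIdeal_of_mem D⁰ ha) hinv using 1
    field_simp
  obtain ⟨d', hd', h⟩ := (FractionalIdeal.mem_coeIdeal D⁰).mp hdN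
  exact hd (hNM (IsFractionRing.injective D K h ▸ hd'))

/-- Take $0 \ne p \in P$ and $q \in Q \setminus P$, with $Q \subseteq M$. As $q$ is not a unit in
the archimedean valuation ring $D_M$, $p$ divides some $q^n$ there, so $dq^n \in P$ with $d \notin
M$, which is impossible for the prime $P$. -/
theorem IsSharp.eq_of_le {s : StarOperation D K} (hsharp : s.IsSharp)
    (hfin : s.IsFiniteCharacter) (hstable : s.IsStable) {P Q : Ideal D} (hP : P.IsPrime)
    (hP0 : P ≠ ⊥) (hQ : Q.IsPrime) (hsQ : s.IsStarIdeal Q) (hPQ : P ≤ Q) : P = Q := by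
  refine le_antisymm hPQ fun q hq => ?_
  by_contra hqP
  obtain ⟨p, hp, hp0⟩ := Submodule.exists_mem_ne_zero_of_ne_bot hP0
  obtain ⟨M, hQM, hM⟩ := s.exists_isMaximalStarIdeal_ge hfin hsQ.1 (by
    rw [hsQ.2, ← FractionalIdeal.coeIdeal_top, Ne, FractionalIdeal.coeIdeal_inj]
    exact hQ.ne_top)
  have := hM.isPrime
  have hsh := hsharp.isSharpRing_localization hstable hM
  have := hsh.valuationRing
  have hinj : Function.Injective (algebraMap D (Localization.AtPrime M)) :=
    IsLocalization.injective _ M.primeCompl_le_nonZeroDivisors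
  obtain ⟨n, hn⟩ := hsh.hasIdealGcd.exists_not_pow_dvd
    (p := algebraMap D (Localization.AtPrime M) p) (q := algebraMap D (Localization.AtPrime M) q)
    ((map_ne_zero_iff _ hinj).mpr hp0)
    (fun h => (IsLocalization.AtPrime.isUnit_to_map_iff _ M q).mp h (hQM hq))
  have hdvd := (ValuationRing.dvd_total _ _).resolve_left hn
  rw [← map_pow] at hdvd
  obtain ⟨d, hd, hpd⟩ := exists_notMem_dvd_mul_of_dvd_localization M hdvd
  rcases hP.mem_or_mem (P.mem_of_dvd hpd hp) with h | h
  · exact hd (hQM (hPQ h))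
  · exact hqP (hP.mem_of_pow_mem n h)

theorem IsSharp.dim_le_one {s : StarOperation D K} (hsharp : s.IsSharp)
    (hfin : s.IsFiniteCharacter) (hstable : s.IsStable) : s.dim ≤ 1 := by
  refine iSup₂_le ?_
  rintro n ⟨P, hmono, hP⟩
  by_contra! hlt
  have hn : 1 < n := by exact_mod_cast hlt
  have h01 : P ⟨0, by omega⟩ < P ⟨1, hn⟩ := hmono (Fin.mk_lt_mk.mpr one_pos)
  exact h01.ne (hsharp.eq_of_le hfin hstable (hP _).1 (hP _).2.1 (hP _).1 (hP _).2 h01.le)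

end StarOperation

theorem mainTheorem1 {D K : Type*} [CommRing D] [IsDomain D] [Field K] [Algebra D K]
    [IsFractionRing D K] (s : StarOperation D K) (hfin : s.IsFiniteCharacter)
    (hstable : s.IsStable) (hsharp : s.IsSharp) :
    (∀ M : Ideal D, s.IsMaximalStarIdeal M →
      ∃ _ : M.IsPrime,
        IsValuationDomainWithCompleteRealValueGroup (Localization.AtPrime M)) ∧
    s.IsPruferMultiplicationDomain ∧
    s.dim ≤ 1 := by
  refine ⟨fun M hM => ⟨hM.isPrime, ?_⟩, hsharp.isPruferMultiplicationDomain hfin hstable,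
    hsharp.dim_le_one hfin hstable⟩
  have := hM.isPrime
  exact (hsharp.isSharpRing_localization hstable hM).isValuationDomainWithCompleteRealValueGroup
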